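/- All systems are finite dimensional with fixed computational bases. An operation (channel) is a completely positive trace-preserving linear map; $\mathcal{X}_{R|Q}$ maps operators on $Q$ to operators on $R$, and maps are tensored with the identity on the systems on which they do not act. $\phi$ denotes the maximally entangled state $|\phi\rangle\langle\phi|$, $|\phi\rangle=K^{-1/2}\sum_{i=1}^K|i\rangle|i\rangle$, of two $K$-dimensional systems, $\mathbf{t}_{B}$ the transpose map on $B$ in the computational basis, and $\le$ the Loewner order. Let $\mathcal{N}_{B|A'}$ be an operation with Choi matrix $N_{A'B}=\sum_{i,j}|i\rangle\langle j|_{A'}\otimes\mathcal{N}(|i\rangle\langle j|)$, let $K\ge 1$ be an integer, $\rho_{A'}$ a state and $f_c$ a real number. A *forward-assisted code of size $K$* consists of finite-dimensional systems $Q,R$ and operations $\mathcal{E}_{A'Q|A}$ (encoder), $\mathcal{F}_{R|Q}$ (side channel), $\mathcal{D}_{B'|RB}$ (decoder), where $\dim A=\dim B'=K$. Its average channel input is $\mathrm{Tr}_{Q\tilde A}\,\mathcal{E}\phi_{A\tilde A}$; with $\mathcal{M}_{B'|A}=\mathcal{D}\mathcal{F}\mathcal{N}\mathcal{E}$, its channel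 fidelity for $\mathcal{N}$ is $\mathrm{Tr}\,\phi_{B'\tilde A}\,\mathcal{M}\phi_{A\tilde A}$; and its bipartite operation is $\mathcal{Z}_{A'B'|AB}=\mathcal{D}\mathcal{F}\mathcal{E}$. The code is * *non-signalling from Alice to Bob* (NS) if there is an operation $\mathcal{Z}^{\mathrm{Bob}}_{B'|B}$ with $\mathrm{Tr}_{A'}\mathcal{Z}=\mathcal{Z}^{\mathrm{Bob}}\,\mathrm{Tr}_{A}$; * *PPT-preserving* (PPTp) if, for all additional systems $\tilde A,\tilde B$ and every state $\sigma_{A\tilde AB\tilde B}$ with $\mathbf{t}_{B\tilde B}\,\sigma\ge 0$, one has $\mathbf{t}_{B'\tilde B}\,\mathcal{Z}\sigma\ge 0$. For an operator $\Lambda_{A'B}$ write $\Lambda_B=\mathrm{Tr}_{A'}\Lambda_{A'B}$ and consider the conditions $$\text{(a)}\quad f_c=\mathrm{Tr}\,N_{A'B}^{T}\Lambda_{A'B},\qquad 0\le\Lambda_{A'B}\le\rho_{A'}\otimes 1_B;$$ $$\text{(b)}\quad \Lambda_B=1_B/K^2;\qquad\qquad \text{(c)}\quad -\rho_{A'}\otimes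 1_B/K\;\le\;\mathbf{t}_{B}[\Lambda_{A'B}]\;\le\;\rho_{A'}\otimes 1_B/K .$$ **Theorem 1.** 1. A forward-assisted code of size $K$ with average channel input $\rho_{A'}$ and channel fidelity $f_c$ for $\mathcal{N}$ which is non-signalling from Alice to Bob exists if and only if some operator $\Lambda_{A'B}$ satisfies (a) and (b). 2. If $K\ge 2$, such a code (with the same parameters) which is PPT-preserving exists if and only if some operator $\Lambda_{A'B}$ satisfies (a) and (c). 3. Such a code which is both PPT-preserving and non-signalling from Alice to Bob exists if and only if some operator $\Lambda_{A'B}$ satisfies (a), (b) and (c). -/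

import Mathlib

open scoped Kronecker ComplexOrder MatrixOrder

noncomputable section

namespace QCode

/-- The linear operators on the Hilbert space `ℂ^Q` of a finite-dimensional system, written in the
computational basis, which is indexed by the finite type `Q`. The composite of systems `P` and `Q`
is indexed by `P × Q`. -/
abbrev Op (Q : Type*) := Matrix Q Q ℂ

section Maps

variable {P Q R : Type*}

/-- The identification of operators that comes from an identification of basis labels. -/
def relabel (e : P ≃ Q) : Op P →ₗ[ℂ] Op Q :=
  (Matrix.reindexLinearEquiv ℂ ℂ e e).toLinearMap

/-- `Φ ⊗ id_S`, for a linear map `Φ` from operators on `Q` to operators on `R`. -/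
def mapFst (S : Type*) (Φ : Op Q →ₗ[ℂ] Op R) : Op (Q × S) →ₗ[ℂ] Op (R × S) where
  toFun X := Matrix.of fun x y => Φ (Matrix.of fun q q' => X (q, x.2) (q', y.2)) x.1 y.1
  map_add' X Y := by
    ext x y
    exact congrFun (congrFun (map_add Φ (Matrix.of fun q q' => X (q, x.2) (q', y.2))
      (Matrix.of fun q q' => Y (q, x.2) (q', y.2))) x.1) y.1
  map_smul' c X := by
    ext x y
    exact congrFun (congrFun (map_smul Φ c (Matrix.of fun q q' => X (q, x.2) (q', y.2))) x.1) y.1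

/-- `id_S ⊗ Φ`, for a linear map `Φ` from operators on `Q` to operators on `R`. -/
def mapSnd (S : Type*) (Φ : Op Q →ₗ[ℂ] Op R) : Op (S × Q) →ₗ[ℂ] Op (S × R) :=
  relabel (Equiv.prodComm R S) ∘ₗ mapFst S Φ ∘ₗ relabel (Equiv.prodComm S Q)

/-- Partial trace over the first factor. -/
def traceFst [Fintype P] (X : Op (P × Q)) : Op Q :=
  Matrix.of fun q q' => ∑ p, X (p, q) (p, q')

/-- Partial trace over the second factor. -/
def traceSnd [Fintype Q] (X : Op (P × Q)) : Op P :=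
  Matrix.of fun p p' => ∑ q, X (p, q) (p', q)

/-- Partial transpose on the second factor. -/
def transposeSnd (X : Op (P × Q)) : Op (P × Q) :=
  Matrix.of fun x y => X (x.1, y.2) (y.1, x.2)

/-- A (normalised) quantum state: a positive semidefinite operator of unit trace. -/
def IsState [Fintype P] (ρ : Op P) : Prop :=
  0 ≤ ρ ∧ ρ.trace = 1

/-- An operation (quantum channel): a completely positive and trace preserving linear map. -/
structure IsOperation [Fintype Q] [Fintype R] (Φ : Op Q →ₗ[ℂ] Op R) : Prop where
  completelyPositive : ∀ (n : ℕ) (X : Op (Q × Fin n)), 0 ≤ X → 0 ≤ mapFst (Fin n) Φ X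
  tracePreserving : ∀ X : Op Q, (Φ X).trace = X.trace

/-- The Choi matrix `∑ i j, |i⟩⟨j| ⊗ Φ(|i⟩⟨j|)`, the input system being the first tensor factor
and the output system the second. -/
def choi [DecidableEq Q] (Φ : Op Q →ₗ[ℂ] Op R) : Op (Q × R) :=
  Matrix.of fun x y => Φ (Matrix.single x.1 y.1 1) x.2 y.2

end Maps

/-- The maximally entangled state `|φ⟩⟨φ|`, with `|φ⟩ = K^{-1/2} ∑ i, |i⟩|i⟩`, of two
`K`-dimensional systems. -/
def maxEntangled (K : ℕ) : Op (Fin K × Fin K) :=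
  Matrix.of fun x y => if x.1 = x.2 ∧ y.1 = y.2 then (K : ℂ)⁻¹ else 0

/-- The channel fidelity `Tr φ_{B'Ã} (M ⊗ id_Ã) φ_{AÃ}` of a map `M` between operators of
`K`-dimensional systems `A` and `B'`. -/
def channelFidelity {K : ℕ} (M : Op (Fin K) →ₗ[ℂ] Op (Fin K)) : ℂ :=
  (maxEntangled K * mapFst (Fin K) M (maxEntangled K)).trace

section Bipartite

variable {A B A' B' : Type*} [Fintype A] [Fintype B] [Fintype A'] [Fintype B']

/-- A bipartite operator on `P × Q` is PPT if its partial transpose is positive semidefinite. -/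
def IsPPT {P Q : Type*} (X : Op (P × Q)) : Prop :=
  0 ≤ transposeSnd X

/-- A bipartite map `Z` (Alice: input `A`, output `A'`; Bob: input `B`, output `B'`) is
PPT-preserving if, for arbitrary additional systems `Ã` held by Alice and `B̃` held by Bob,
`Z ⊗ id_{ÃB̃}` takes every state that is PPT across the partition `AÃ : BB̃` to an operator that is
PPT across the partition `A'Ã : B'B̃`. -/
def IsPPTPreserving (Z : Op (A × B) →ₗ[ℂ] Op (A' × B')) : Prop :=
  ∀ (m n : ℕ) (σ : Op ((A × Fin m) × (B × Fin n))), IsState σ → IsPPT σ →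
    IsPPT (relabel (Equiv.prodProdProdComm A' B' (Fin m) (Fin n))
      (mapFst (Fin m × Fin n) Z
        (relabel (Equiv.prodProdProdComm A (Fin m) B (Fin n)) σ)))

/-- A bipartite map `Z` is non-signalling from Alice to Bob if Bob's marginal output is obtained
by a fixed operation from Bob's marginal input. -/
def IsNonSignallingAB (Z : Op (A × B) →ₗ[ℂ] Op (A' × B')) : Prop :=
  ∃ ZBob : Op B →ₗ[ℂ] Op B', IsOperation ZBob ∧
    ∀ X : Op (A × B), traceFst (Z X) = ZBob (traceFst X)

end Bipartite

/-- A forward-assisted code of size `K` for channels from `A'` to `B`: an encoding operation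
`E : A → A'Q` of Alice, a side channel `F : Q → R`, and a decoding operation `D : RB → B'` of Bob,
where `A` and `B'` have dimension `K` and `Q`, `R` are arbitrary finite-dimensional systems. -/
structure ForwardCode (K : ℕ) (A' B : Type*) [Fintype A'] [Fintype B] where
  dimQ : ℕ
  dimR : ℕ
  E : Op (Fin K) →ₗ[ℂ] Op (A' × Fin dimQ)
  F : Op (Fin dimQ) →ₗ[ℂ] Op (Fin dimR)
  D : Op (Fin dimR × B) →ₗ[ℂ] Op (Fin K)
  isOperation_E : IsOperation E
  isOperation_F : IsOperation F
  isOperation_D : IsOperation D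

namespace ForwardCode

variable {K : ℕ} {A' B : Type*} [Fintype A'] [Fintype B]

/-- The overall map `M = D F N E : A → B'` when the code is used with the channel `N`. -/
def overall (C : ForwardCode K A' B) (N : Op A' →ₗ[ℂ] Op B) : Op (Fin K) →ₗ[ℂ] Op (Fin K) :=
  C.D ∘ₗ mapFst B C.F ∘ₗ relabel (Equiv.prodComm B (Fin C.dimQ)) ∘ₗ mapFst (Fin C.dimQ) N ∘ₗ C.E

/-- The bipartite map `Z = D F E : AB → A'B'` of the code. -/
def bipartite (C : ForwardCode K A' B) : Op (Fin K × B) →ₗ[ℂ] Op (A' × Fin K) :=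
  mapSnd A' (C.D ∘ₗ mapFst B C.F) ∘ₗ relabel (Equiv.prodAssoc A' (Fin C.dimQ) B) ∘ₗ mapFst B C.E

/-- The average channel input `Tr_{QÃ} (E ⊗ id_Ã) φ_{AÃ}`. -/
def averageInput (C : ForwardCode K A' B) : Op A' :=
  traceSnd (traceSnd (mapFst (Fin K) C.E (maxEntangled K)))

end ForwardCode

/-- The conditions `f = Tr N^T Λ` and `0 ≤ Λ ≤ ρ ⊗ 1` on an operator `Λ` on `A'B`. -/
def IsFeasible {A' B : Type*} [Fintype A'] [Fintype B] [DecidableEq A'] [DecidableEq B]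
    (N : Op A' →ₗ[ℂ] Op B) (ρ : Op A') (f : ℝ) (Λ : Op (A' × B)) : Prop :=
  (f : ℂ) = ((choi N).transpose * Λ).trace ∧ Λ ≤ ρ ⊗ₖ (1 : Op B) ∧ 0 ≤ Λ

/-- The condition `Λ_B = 1 / K ^ 2`. -/
def NSCondition {A' B : Type*} [Fintype A'] [DecidableEq B]
    (K : ℕ) (Λ : Op (A' × B)) : Prop :=
  traceFst Λ = ((K : ℂ) ^ 2)⁻¹ • (1 : Op B)

/-- The condition `-(ρ ⊗ 1) / K ≤ t_B(Λ) ≤ (ρ ⊗ 1) / K`. -/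
def PPTCondition {A' B : Type*} [DecidableEq B]
    (K : ℕ) (ρ : Op A') (Λ : Op (A' × B)) : Prop :=
  -((K : ℂ)⁻¹ • ρ ⊗ₖ (1 : Op B)) ≤ transposeSnd Λ ∧
    transposeSnd Λ ≤ (K : ℂ)⁻¹ • ρ ⊗ₖ (1 : Op B)

end QCode

end

/-!
The proof works with Choi matrices: a map is an operation iff its Choi matrix is positive with
partial trace `1` over the output (`QCode.isOperation_iff_choi`), and a bipartite map is
PPT-preserving iff the partial transpose of its Choi matrix on Bob's systems is positive
(`QCode.isPPTPreserving_iff`). Positivity is always transported by contracting a positive operator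
on `AB'A'B` with a positive operator on `AB'` (`QCode.posSemidef_contract`).

*From a code to `Λ`.* Write `Z` for the Choi matrix of the bipartite map and `Φ = ∑ i, |i⟩|i⟩` on
`AB'`. The channel fidelity is linear in the channel, and `Λ = K⁻² ⟨Φ|Z|Φ⟩`
(`QCode.ForwardCode.fidelityOp`) represents it. Bob cannot signal to Alice, so that
`Tr_{AB'} Z = K ρ ⊗ 1` (`QCode.ForwardCode.collapse_one`). Then `0 ≤ |Φ⟩⟨Φ| ≤ K` gives
`0 ≤ Λ ≤ ρ ⊗ 1`. The partial transpose of `|Φ⟩⟨Φ|` is the swap operator `F`, hence `t_B(Λ)` is the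
contraction of the partial transpose of `Z` with `K⁻² F`, and `-1 ≤ F ≤ 1` gives the PPT condition.
The non-signalling condition is a direct evaluation of `Tr_{A'} Z`.

*From `Λ` to a code.* The code should have the Choi matrix
`Λ ⊗ |Φ⟩⟨Φ| + (ρ ⊗ 1 - Λ) ⊗ (K - |Φ⟩⟨Φ|) / (K ^ 2 - 1)`. To realise it with forward assistance
(`QCode.exists_code`), factor `Λ = (√ρ ⊗ 1) M (√ρ ⊗ 1)` with `0 ≤ M ≤ 1`
(`QCode.exists_sandwich`). Alice feeds a purification of `ρ` to the channel and gives its other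
half and her input to Bob, whose measurement of `M` decides whether he returns her input as it is or
after a channel which sends the maximally entangled state to its normalised complement. The
non-signalling and PPT properties are then read off the Choi matrix. For `K = 1` the complement is
zero, and the non-signalling condition forces `Λ = ρ ⊗ 1`.
-/

noncomputable section

namespace QCode

/-! ### Positive semidefinite matrices -/

section PosSemidef

variable {I T n : Type*}

lemma posSemidef_of_entries {X Y : Op n} (hX : X.PosSemidef) (h : ∀ x y, Y x y = X x y) :
    Y.PosSemidef := by
  rwa [show Y = X from Matrix.ext h]

/-- Contracting the index `I` of a positive matrix on `I × T` with a positive matrix on `I` gives a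
positive matrix: by the Kronecker product `W ⊗ P` restricted to the diagonal of `I × I` and
compressed by the all-ones vector of `I`. -/
lemma posSemidef_contract [Fintype I] [Fintype T] {W : Op I} {P : Op (I × T)}
    (hW : W.PosSemidef) (hP : P.PosSemidef) :
    (Matrix.of fun t t' => ∑ p, ∑ q, W p q * P (p, t) (q, t') : Op T).PosSemidef := by
  classical
  let V : Matrix T (I × T) ℂ := Matrix.of fun t x => if x.2 = t then 1 else 0
  have h := ((hW.kronecker hP).submatrix fun x : I × T => (x.1, x)).mul_mul_conjTranspose_same V
  have e : V * ((W ⊗ₖ P).submatrix (fun x : I × T => (x.1, x)) fun x : I × T => (x.1, x)) *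
      V.conjTranspose = Matrix.of fun t t' => ∑ p, ∑ q, W p q * P (p, t) (q, t') := by
    ext t t'
    simp only [Matrix.mul_apply, Matrix.of_apply, Matrix.submatrix_apply,
      Matrix.kroneckerMap_apply, Matrix.conjTranspose_apply, V, Fintype.sum_prod_type,
      apply_ite star, star_one, star_zero, ite_mul, mul_ite, one_mul, mul_one, zero_mul, mul_zero,
      Finset.sum_ite_eq', Finset.mem_univ, if_true]
    exact Finset.sum_comm
  rwa [e] at h

/-- A Hermitian matrix whose square is a positive multiple of itself is positive. -/
lemma posSemidef_of_mul_self_eq_smul [Fintype n] {H : Op n} (hH : H.IsHermitian) {c : ℝ}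
    (hc : 0 < c) (h : H * H = (c : ℂ) • H) : H.PosSemidef := by
  have h1 : (H.conjTranspose * H).PosSemidef := Matrix.posSemidef_conjTranspose_mul_self H
  rw [hH.eq, h] at h1
  have h2 := h1.smul (a := ((c⁻¹ : ℝ) : ℂ)) (by exact_mod_cast (inv_pos.2 hc).le)
  rwa [smul_smul, ← Complex.ofReal_mul, inv_mul_cancel₀ hc.ne', Complex.ofReal_one, one_smul] at h2

/-- A Hermitian matrix has a Hermitian generalised inverse which commutes with it. -/
lemma exists_hermitian_pinv [Fintype n] {S : Op n} (hS : S.IsHermitian) :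
    ∃ P : Op n, P.IsHermitian ∧ S * P = P * S ∧ S * P * S = S := by
  classical
  let U : Op n := hS.eigenvectorUnitary
  let d : n → ℂ := RCLike.ofReal ∘ hS.eigenvalues
  have hU : star U * U = 1 := Unitary.coe_star_mul_self hS.eigenvectorUnitary
  have hSd : S = U * Matrix.diagonal d * star U := hS.spectral_theorem
  have hconj : ∀ x y : n → ℂ, (U * Matrix.diagonal x * star U) * (U * Matrix.diagonal y * star U)
      = U * Matrix.diagonal (fun i => x i * y i) * star U := by
    intro x y
    rw [← Matrix.diagonal_mul_diagonal]
    calc _ = U * Matrix.diagonal x * (star U * U) * Matrix.diagonal y * star U := by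
          simp only [Matrix.mul_assoc]
      _ = _ := by rw [hU]; simp only [Matrix.mul_assoc, Matrix.mul_one]
  refine ⟨U * Matrix.diagonal (fun i => (d i)⁻¹) * star U, ?_, ?_, ?_⟩
  · refine Matrix.isHermitian_mul_mul_conjTranspose U ?_
    refine Matrix.isHermitian_diagonal_of_self_adjoint _ (funext fun i => ?_)
    simp [d]
  · rw [hSd, hconj, hconj]
    simp only [mul_comm]
  · rw [hSd, hconj, hconj]
    congr 3
    ext i
    -- also at a zero eigenvalue, since `0⁻¹ = 0`
    exact mul_inv_mul_cancel (d i)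

/-- A form of Douglas' factorisation lemma: if `0 ≤ Λ ≤ S ^ 2` then `Λ = S M S` for some
`0 ≤ M ≤ 1`. -/
lemma exists_sandwich [Fintype n] [DecidableEq n] {S L : Op n} (hS : S.IsHermitian)
    (h0 : L.PosSemidef) (h1 : (S * S - L).PosSemidef) :
    ∃ M : Op n, M.PosSemidef ∧ (1 - M).PosSemidef ∧ L = S * M * S := by
  obtain ⟨P, hP, hcomm, hSPS⟩ := exists_hermitian_pinv hS
  have hPS : P.conjTranspose = P := hP
  have hSS : S.conjTranspose = S := hS
  have hidem : (S * P) * (S * P) = S * P := by rw [← Matrix.mul_assoc, hSPS]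
  have hX : (1 - S * P).conjTranspose = 1 - S * P := by
    rw [Matrix.conjTranspose_sub, Matrix.conjTranspose_mul, hPS, hSS, hcomm,
      Matrix.conjTranspose_one]
  have hXS : (1 - S * P) * S = 0 := by rw [Matrix.sub_mul, hSPS, Matrix.one_mul, sub_self]
  -- `L` vanishes on the kernel of `S`
  have hLX : L * (1 - S * P) = 0 := by
    have h2 := h1.conjTranspose_mul_mul_same (1 - S * P)
    have h3 := h0.conjTranspose_mul_mul_same (1 - S * P)
    have e : (1 - S * P) * (S * S - L) * (1 - S * P) = -((1 - S * P) * L * (1 - S * P)) := by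
      rw [Matrix.mul_sub (1 - S * P) (S * S), ← Matrix.mul_assoc, hXS, Matrix.zero_mul, zero_sub,
        Matrix.neg_mul]
    rw [hX, e] at h2
    rw [hX] at h3
    have h4 : (1 - S * P) * L * (1 - S * P) = 0 :=
      le_antisymm (neg_nonneg.1 h2.nonneg) h3.nonneg
    obtain ⟨Y, rfl⟩ := CStarAlgebra.nonneg_iff_eq_star_mul_self.1 h0.nonneg
    have h5 : (Y * (1 - S * P)).conjTranspose * (Y * (1 - S * P)) = 0 := by
      rw [Matrix.conjTranspose_mul, hX, ← h4, Matrix.star_eq_conjTranspose]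
      simp only [Matrix.mul_assoc]
    rw [Matrix.mul_assoc, Matrix.conjTranspose_mul_self_eq_zero.1 h5, Matrix.mul_zero]
  have hL1 : L * (S * P) = L := by
    rw [Matrix.mul_sub, Matrix.mul_one, sub_eq_zero] at hLX
    exact hLX.symm
  have hL2 : (S * P) * L = L := by
    have h := congrArg Matrix.conjTranspose hL1
    rwa [Matrix.conjTranspose_mul, h0.1.eq, Matrix.conjTranspose_mul, hPS, hSS, ← hcomm] at h
  refine ⟨P * L * P, ?_, ?_, ?_⟩
  · have := h0.conjTranspose_mul_mul_same P
    rwa [hPS] at this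
  · have h2 := h1.conjTranspose_mul_mul_same P
    have h3 := Matrix.posSemidef_conjTranspose_mul_self (1 - S * P)
    convert h3.add h2 using 1
    have h6 : P * (S * S) * P = S * P := by
      calc P * (S * S) * P = (P * S) * (S * P) := by simp only [Matrix.mul_assoc]
        _ = S * P := by rw [← hcomm, hidem]
    have h7 : (1 - S * P) * (1 - S * P) = 1 - S * P := by
      rw [Matrix.mul_sub, Matrix.sub_mul, Matrix.sub_mul, hidem]
      simp
    rw [hX, hPS, h7, Matrix.mul_sub, Matrix.sub_mul, h6]
    abel
  · calc L = (S * P) * L * (S * P) := by rw [hL2, hL1]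
      _ = S * (P * L * P) * S := by rw [hcomm]; nth_rw 1 [← hcomm]; simp only [Matrix.mul_assoc]

end PosSemidef

/-! ### Choi matrices -/

section Choi

variable {Q R S : Type*} [Fintype Q]

lemma apply_eq_sum_choi [DecidableEq Q] (Φ : Op Q →ₗ[ℂ] Op R) (X : Op Q) (r r' : R) :
    Φ X r r' = ∑ q, ∑ q', X q q' * choi Φ (q, r) (q', r') := by
  conv_lhs => rw [Matrix.matrix_eq_sum_single X]
  simp only [map_sum, Matrix.sum_apply]
  refine Finset.sum_congr rfl fun q _ => Finset.sum_congr rfl fun q' _ => ?_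
  rw [show Matrix.single q q' (X q q') = X q q' • Matrix.single q q' 1 by simp, map_smul]
  rfl

/-- The linear map with a given Choi matrix. -/
def ofChoi (C : Op (Q × R)) : Op Q →ₗ[ℂ] Op R where
  toFun X := Matrix.of fun r r' => ∑ q, ∑ q', X q q' * C (q, r) (q', r')
  map_add' X Y := by
    ext r r'
    simp [add_mul, Finset.sum_add_distrib]
  map_smul' c X := by
    ext r r'
    simp [mul_assoc, Finset.mul_sum]

lemma ofChoi_apply (C : Op (Q × R)) (X : Op Q) (r r' : R) :
    ofChoi C X r r' = ∑ q, ∑ q', X q q' * C (q, r) (q', r') := rfl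

lemma choi_ofChoi [DecidableEq Q] (C : Op (Q × R)) : choi (ofChoi C) = C := by
  ext ⟨q, r⟩ ⟨q', r'⟩
  simp [choi, ofChoi_apply, Matrix.single_apply, ite_and, Finset.sum_ite_eq]

end Choi

section Operations

variable {P Q R T : Type*} [Fintype P] [Fintype Q] [Fintype R] [Fintype T]

/-- The operator is `|v⟩⟨v|` for the unnormalised vector `v = ∑ q, |q⟩|e q⟩`. -/
lemma posSemidef_graph {Q S : Type*} [Fintype Q] [Fintype S] [DecidableEq S] (e : Q → S) :
    (Matrix.of fun x y => if e x.1 = x.2 ∧ e y.1 = y.2 then 1 else 0 : Op (Q × S)).PosSemidef := by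
  refine posSemidef_of_entries (Matrix.posSemidef_vecMulVec_self_star
    (fun x : Q × S => if e x.1 = x.2 then (1 : ℂ) else 0)) fun x y => ?_
  simp only [Matrix.of_apply, Matrix.vecMulVec_apply, Pi.star_apply, apply_ite star, star_one,
    star_zero, ite_and, ite_mul, one_mul, zero_mul]

/-- The link product of Choi matrices, the contraction over a common system `Q`, preserves
positivity. -/
lemma posSemidef_link {U V : Type*} [Fintype U] [Fintype V] {X : Op (Q × U)} {Y : Op (Q × V)}
    (hX : X.PosSemidef) (hY : Y.PosSemidef) :
    (Matrix.of fun t t' => ∑ q, ∑ q', X (q, t.1) (q', t'.1) * Y (q, t.2) (q', t'.2) :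
      Op (U × V)).PosSemidef := by
  have h1 : (Matrix.of fun _ _ => 1 : Op Q).PosSemidef := by
    refine posSemidef_of_entries (Matrix.posSemidef_vecMulVec_self_star (fun _ : Q => (1 : ℂ)))
      fun x y => ?_
    simp [Matrix.vecMulVec_apply]
  have h := posSemidef_contract h1 ((hX.kronecker hY).submatrix
    fun x : Q × U × V => ((x.1, x.2.1), (x.1, x.2.2)))
  simpa only [Matrix.of_apply, Matrix.submatrix_apply, Matrix.kroneckerMap_apply, one_mul] using h

lemma mapFst_apply {Q R : Type*} [Fintype Q] [DecidableEq Q] (S : Type*) (Φ : Op Q →ₗ[ℂ] Op R)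
    (X : Op (Q × S)) (x y : R × S) :
    mapFst S Φ X x y = ∑ q, ∑ q', X (q, x.2) (q', y.2) * choi Φ (q, x.1) (q', y.1) :=
  apply_eq_sum_choi Φ _ _ _

lemma posSemidef_mapFst [DecidableEq Q] {S : Type*} [Fintype S] {Φ : Op Q →ₗ[ℂ] Op R}
    (hΦ : (choi Φ).PosSemidef) {X : Op (Q × S)} (hX : X.PosSemidef) :
    (mapFst S Φ X).PosSemidef := by
  exact posSemidef_of_entries ((posSemidef_link hX hΦ).submatrix Prod.swap)
    fun x y => mapFst_apply S Φ X x y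

/-- Choi's theorem: complete positivity and trace preservation in terms of the Choi matrix. -/
lemma isOperation_iff_choi [DecidableEq Q] (Φ : Op Q →ₗ[ℂ] Op R) :
    IsOperation Φ ↔ (choi Φ).PosSemidef ∧ traceSnd (choi Φ) = 1 := by
  constructor
  · intro h
    constructor
    · let e := Fintype.equivFin Q
      have h1 := h.completelyPositive _ _ (posSemidef_graph e).nonneg
      have h2 := (Matrix.nonneg_iff_posSemidef.1 h1).submatrix fun x : Q × R => (x.2, e x.1)
      refine posSemidef_of_entries h2 fun x y => ?_
      simp [mapFst_apply, ite_and]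
    · ext q q'
      have h1 := h.tracePreserving (Matrix.single q q' 1)
      have h2 : (Matrix.single q q' (1 : ℂ)).trace = (1 : Op Q) q q' := by
        by_cases hq : q = q'
        · subst hq
          simp
        · simp [hq]
      rw [h2] at h1
      exact h1
  · rintro ⟨h1, h2⟩
    refine ⟨fun n X hX => (posSemidef_mapFst h1 (Matrix.nonneg_iff_posSemidef.1 hX)).nonneg,
      fun X => ?_⟩
    have h3 : ∀ q q', ∑ r, choi Φ (q, r) (q', r) = if q = q' then 1 else 0 := fun q q' => by
      have := congrFun (congrFun h2 q) q'
      rwa [Matrix.one_apply] at this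
    simp only [Matrix.trace, Matrix.diag_apply, apply_eq_sum_choi Φ X]
    rw [Finset.sum_comm]
    refine Finset.sum_congr rfl fun q _ => ?_
    rw [Finset.sum_comm]
    simp only [← Finset.mul_sum, h3]
    simp

lemma choi_mapFst {Q R : Type*} [Fintype Q] [DecidableEq Q] {S : Type*} [DecidableEq S]
    (Φ : Op Q →ₗ[ℂ] Op R) (x y : (Q × S) × (R × S)) :
    choi (mapFst S Φ) x y = choi Φ (x.1.1, x.2.1) (y.1.1, y.2.1) *
      if x.1.2 = x.2.2 ∧ y.1.2 = y.2.2 then 1 else 0 := by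
  obtain ⟨⟨q, s⟩, r, t⟩ := x
  obtain ⟨⟨q', s'⟩, r', t'⟩ := y
  change mapFst S Φ (Matrix.single (q, s) (q', s') 1) (r, t) (r', t') = _
  rw [mapFst_apply]
  simp [Matrix.single_apply, ite_and]
 
lemma IsOperation.mapFst {S : Type*} [Fintype S] {Φ : Op Q →ₗ[ℂ] Op R} (h : IsOperation Φ) :
    IsOperation (mapFst S Φ) := by
  classical
  rw [isOperation_iff_choi] at h ⊢
  constructor
  · exact posSemidef_of_entries ((h.1.kronecker (posSemidef_graph (fun s : S => s))).submatrix
      (fun x : (Q × S) × (R × S) => ((x.1.1, x.2.1), (x.1.2, x.2.2)))) fun x y => choi_mapFst Φ x y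
  · ext ⟨q, s⟩ ⟨q', s'⟩
    have h1 : ∑ r, choi Φ (q, r) (q', r) = (1 : Op Q) q q' := congrFun (congrFun h.2 q) q'
    simp only [traceSnd, Matrix.of_apply, choi_mapFst, Fintype.sum_prod_type, ← Finset.mul_sum,
      ite_and, Finset.sum_ite_eq, Finset.mem_univ, if_true]
    by_cases hs : s' = s
    · subst hs
      simp [h1, Matrix.one_apply]
    · simp [hs, Ne.symm hs]

lemma IsOperation.comp {Φ : Op P →ₗ[ℂ] Op Q} {Ψ : Op Q →ₗ[ℂ] Op R} (hΨ : IsOperation Ψ)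
    (hΦ : IsOperation Φ) : IsOperation (Ψ ∘ₗ Φ) :=
  ⟨fun n X hX => hΨ.completelyPositive n _ (hΦ.completelyPositive n X hX),
    fun X => (hΨ.tracePreserving _).trans (hΦ.tracePreserving X)⟩

lemma IsOperation.id : IsOperation (LinearMap.id : Op Q →ₗ[ℂ] Op Q) :=
  ⟨fun _ _ hX => hX, fun _ => rfl⟩

end Operations

/-! ### The bipartite map of a forward-assisted code -/

section Code

variable {K : ℕ} {A' B : Type*} [Fintype A'] [Fintype B]

/-- Bob's part of a code: the side channel followed by the decoder. -/
def ForwardCode.receiver (C : ForwardCode K A' B) : Op (Fin C.dimQ × B) →ₗ[ℂ] Op (Fin K) :=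
  C.D ∘ₗ mapFst B C.F

lemma ForwardCode.isOperation_receiver (C : ForwardCode K A' B) : IsOperation C.receiver :=
  C.isOperation_D.comp C.isOperation_F.mapFst

/-- The Choi matrix of the bipartite map is the link product of those of the encoder and of Bob's
part. -/
lemma ForwardCode.choi_bipartite [DecidableEq B] (C : ForwardCode K A' B)
    (x y : (Fin K × B) × (A' × Fin K)) :
    choi C.bipartite x y = ∑ q, ∑ q', choi C.E (x.1.1, (x.2.1, q)) (y.1.1, (y.2.1, q')) *
      choi C.receiver ((q, x.1.2), x.2.2) ((q', y.1.2), y.2.2) := by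
  obtain ⟨⟨i, b⟩, a, k⟩ := x
  obtain ⟨⟨j, b'⟩, a', l⟩ := y
  change mapFst A' C.receiver _ (k, a) (l, a') = _
  rw [mapFst_apply]
  simp only [Fintype.sum_prod_type]
  change ∑ q, ∑ c, ∑ q', ∑ c', mapFst B C.E (Matrix.single (i, b) (j, b') 1) ((a, q), c)
    ((a', q'), c') * choi C.receiver ((q, c), k) ((q', c'), l) = _
  have h : ∀ q c q' c', mapFst B C.E (Matrix.single (i, b) (j, b') 1) ((a, q), c) ((a', q'), c')
      = if b = c then (if b' = c' then choi C.E (i, (a, q)) (j, (a', q')) else 0) else 0 := by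
    intro q c q' c'
    have h1 := choi_mapFst (S := B) C.E ((i, b), ((a, q), c)) ((j, b'), ((a', q'), c'))
    rw [mul_ite, mul_one, mul_zero, ite_and] at h1
    exact h1
  simp only [h, ite_mul, zero_mul]
  refine Finset.sum_congr rfl fun q _ => ?_
  rw [Finset.sum_comm]
  refine Finset.sum_congr rfl fun q' _ => ?_
  rw [Finset.sum_comm]
  simp

lemma ForwardCode.posSemidef_choi_bipartite [DecidableEq B] (C : ForwardCode K A' B) :
    (choi C.bipartite).PosSemidef := by
  classical
  have hE := ((isOperation_iff_choi _).1 C.isOperation_E).1.submatrix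
    fun x : Fin C.dimQ × (Fin K × A') => (x.2.1, (x.2.2, x.1))
  have hD := ((isOperation_iff_choi _).1 C.isOperation_receiver).1.submatrix
    fun x : Fin C.dimQ × (B × Fin K) => ((x.1, x.2.1), x.2.2)
  exact posSemidef_of_entries ((posSemidef_link hE hD).submatrix
    fun x : (Fin K × B) × (A' × Fin K) => ((x.1.1, x.2.1), (x.1.2, x.2.2))) C.choi_bipartite

lemma ForwardCode.choi_overall [DecidableEq A'] [DecidableEq B] (C : ForwardCode K A' B)
    (N : Op A' →ₗ[ℂ] Op B) (x y : Fin K × Fin K) :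
    choi (C.overall N) x y = ∑ u : A' × B, ∑ v : A' × B, choi N u v *
      choi C.bipartite ((x.1, u.2), (u.1, x.2)) ((y.1, v.2), (v.1, y.2)) := by
  obtain ⟨i, k⟩ := x
  obtain ⟨j, l⟩ := y
  change C.receiver _ k l = _
  rw [apply_eq_sum_choi]
  simp only [choi_bipartite]
  change ∑ p : Fin C.dimQ × B, ∑ p' : Fin C.dimQ × B,
    mapFst (Fin C.dimQ) N (C.E (Matrix.single i j 1)) (p.2, p.1) (p'.2, p'.1) *
      choi C.receiver (p, k) (p', l) = _
  simp only [mapFst_apply, Finset.mul_sum, Finset.sum_mul, Fintype.sum_prod_type]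
  -- both sides are sums over the indices of `Q`, `B` and `A'`, in different orders
  simp only [← Fintype.sum_prod_type']
  refine Fintype.sum_equiv ⟨fun z => ⟨z.2.2.2.2.1, z.2.1, z.2.2.2.2.2, z.2.2.2.1, z.1, z.2.2.1⟩,
    fun z => ⟨z.2.2.2.2.1, z.2.1, z.2.2.2.2.2, z.2.2.2.1, z.1, z.2.2.1⟩,
    fun _ => rfl, fun _ => rfl⟩ _ _ fun z => ?_
  obtain ⟨q, b, q', b', a, a'⟩ := z
  change choi C.E (i, (a, q)) (j, (a', q')) * choi N (a, b) (a', b') *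
      choi C.receiver ((q, b), k) ((q', b'), l) =
    choi N (a, b) (a', b') *
      (choi C.E (i, (a, q)) (j, (a', q')) * choi C.receiver ((q, b), k) ((q', b'), l))
  ring

end Code

/-! ### PPT-preserving maps -/

section PPT

variable {A B A' B' : Type*}

/-- The partial transpose, on both of Bob's systems, of a Choi matrix of a bipartite map. -/
def transposeBob (C : Op ((A × B) × (A' × B'))) : Op ((A × B) × (A' × B')) :=
  Matrix.of fun x y => C ((x.1.1, y.1.2), (x.2.1, y.2.2)) ((y.1.1, x.1.2), (y.2.1, x.2.2))

variable [Fintype A] [Fintype B] [DecidableEq A] [DecidableEq B]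

/-- The partial transpose of the output of `Z` is `t_B' Z t_B` applied to the partial transpose of
the input. -/
lemma transposeSnd_output (Z : Op (A × B) →ₗ[ℂ] Op (A' × B')) {m n : ℕ}
    (σ : Op ((A × Fin m) × (B × Fin n))) (x y : (A' × Fin m) × (B' × Fin n)) :
    transposeSnd (relabel (Equiv.prodProdProdComm A' B' (Fin m) (Fin n))
      (mapFst (Fin m × Fin n) Z
        (relabel (Equiv.prodProdProdComm A (Fin m) B (Fin n)) σ))) x y =
    ∑ p : A × B, ∑ q : A × B,
      transposeSnd σ ((p.1, x.1.2), (p.2, x.2.2)) ((q.1, y.1.2), (q.2, y.2.2)) *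
        transposeBob (choi Z) (p, (x.1.1, x.2.1)) (q, (y.1.1, y.2.1)) := by
  obtain ⟨⟨a, s⟩, b, t⟩ := x
  obtain ⟨⟨a', s'⟩, b', t'⟩ := y
  change mapFst (Fin m × Fin n) Z (relabel (Equiv.prodProdProdComm A (Fin m) B (Fin n)) σ)
    ((a, b'), (s, t')) ((a', b), (s', t)) = _
  rw [mapFst_apply]
  simp only [← Fintype.sum_prod_type']
  -- exchange the row and column indices of Bob's input
  exact Fintype.sum_equiv ⟨fun z : (A × B) × (A × B) => ((z.1.1, z.2.2), (z.2.1, z.1.2)),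
    fun z => ((z.1.1, z.2.2), (z.2.1, z.1.2)), fun _ => rfl, fun _ => rfl⟩ _ _ fun _ => rfl

/-- A bipartite map is PPT-preserving iff its Choi matrix has positive partial transpose: the
maximally entangled states of `AÃ` and of `BB̃` detect this, and it suffices by Choi's theorem. -/
lemma isPPTPreserving_iff [Fintype A'] [Fintype B'] [Nonempty A] [Nonempty B]
    (Z : Op (A × B) →ₗ[ℂ] Op (A' × B')) :
    IsPPTPreserving Z ↔ (transposeBob (choi Z)).PosSemidef := by
  constructor
  · intro h
    let e := Fintype.equivFin A
    let g := Fintype.equivFin B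
    let G : Op ((A × Fin (Fintype.card A)) × (B × Fin (Fintype.card B))) :=
      (Matrix.of fun x y => if e x.1 = x.2 ∧ e y.1 = y.2 then 1 else 0 :
        Op (A × Fin (Fintype.card A))) ⊗ₖ
      (Matrix.of fun x y => if g x.1 = x.2 ∧ g y.1 = y.2 then 1 else 0 :
        Op (B × Fin (Fintype.card B)))
    have hG : G.PosSemidef := (posSemidef_graph e).kronecker (posSemidef_graph g)
    have hGt : transposeSnd G = G := by
      ext ⟨x, u⟩ ⟨y, v⟩
      simp only [transposeSnd, G, Matrix.of_apply, Matrix.kroneckerMap_apply]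
      congr 1
      simp only [and_comm]
    have hc : 0 < (Fintype.card A : ℝ) * Fintype.card B := by
      have := Fintype.card_pos (α := A)
      have := Fintype.card_pos (α := B)
      positivity
    have htr : G.trace = (Fintype.card A : ℂ) * Fintype.card B := by
      rw [Matrix.trace_kronecker]
      simp only [Matrix.trace, Matrix.diag_apply, Matrix.of_apply, and_self, Fintype.sum_prod_type,
        Finset.sum_ite_eq, Finset.mem_univ, if_true]
      simp
    let c : ℂ := (((Fintype.card A : ℝ) * Fintype.card B)⁻¹ : ℝ)
    have hc0 : 0 ≤ c := by
      change (0 : ℂ) ≤ ((_ : ℝ) : ℂ)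
      exact_mod_cast (inv_pos.2 hc).le
    have hc1 : c * ((Fintype.card A : ℂ) * Fintype.card B) = 1 := by
      change (((_ : ℝ)⁻¹ : ℝ) : ℂ) * _ = 1
      have : ((Fintype.card A : ℝ) * Fintype.card B)⁻¹ * ((Fintype.card A : ℝ) * Fintype.card B)
        = 1 := inv_mul_cancel₀ hc.ne'
      exact_mod_cast this
    have hcG : (c • G).PosSemidef := hG.smul hc0
    have hcGt : transposeSnd (c • G) = c • G := by
      conv_rhs => rw [← hGt]
      rfl
    have h1 := h _ _ (c • G) ⟨hcG.nonneg, by rw [Matrix.trace_smul, htr, smul_eq_mul, hc1]⟩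
      (by rw [IsPPT, hcGt]; exact hcG.nonneg)
    have h2 := ((Matrix.nonneg_iff_posSemidef.1 h1).submatrix
      fun x : (A × B) × (A' × B') => ((x.2.1, e x.1.1), (x.2.2, g x.1.2))).smul hG.trace_nonneg
    refine posSemidef_of_entries h2 fun x y => ?_
    have hterm : ∀ p q : A × B,
        (c • G) ((p.1, e x.1.1), (p.2, g x.1.2)) ((q.1, e y.1.1), (q.2, g y.1.2)) =
          if p = x.1 then (if q = y.1 then c else 0) else 0 := by
      intro p q
      simp only [Matrix.smul_apply, smul_eq_mul, G, Matrix.kroneckerMap_apply, Matrix.of_apply,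
        EmbeddingLike.apply_eq_iff_eq, Prod.ext_iff]
      grind
    rw [Matrix.smul_apply, Matrix.submatrix_apply, transposeSnd_output, hcGt]
    simp only [hterm, ite_mul, zero_mul, Finset.sum_ite_irrel, Finset.sum_const_zero,
      Finset.sum_ite_eq', Finset.mem_univ, if_true]
    rw [smul_eq_mul, ← mul_assoc, mul_comm _ c, htr, hc1, one_mul]
  · intro h m n σ _ hσ
    refine Matrix.PosSemidef.nonneg ?_
    have h1 := (Matrix.nonneg_iff_posSemidef.1 hσ).submatrix
      fun x : (A × B) × (Fin m × Fin n) => ((x.1.1, x.2.1), (x.1.2, x.2.2))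
    exact posSemidef_of_entries ((posSemidef_link h1 h).submatrix
      fun x : (A' × Fin m) × (B' × Fin n) => ((x.1.2, x.2.2), (x.1.1, x.2.1)))
      (transposeSnd_output Z σ)

end PPT

/-! ### Invariant operators of two `K`-dimensional systems -/

section Invariant

variable (K : ℕ)

/-- The unnormalised maximally entangled operator `K φ`. -/
def ent : Op (Fin K × Fin K) :=
  Matrix.of fun x y => if x.1 = x.2 ∧ y.1 = y.2 then 1 else 0

/-- The swap operator, the partial transpose of `ent K`. -/
def swap : Op (Fin K × Fin K) :=
  Matrix.of fun x y => if x.1 = y.2 ∧ x.2 = y.1 then 1 else 0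

lemma posSemidef_ent : (ent K).PosSemidef := posSemidef_graph fun i : Fin K => i

lemma ent_mul_ent : ent K * ent K = (K : ℂ) • ent K := by
  ext x y
  simp [ent, Matrix.mul_apply, Fintype.sum_prod_type, ite_and]
  split_ifs <;> rfl

lemma swap_mul_swap : swap K * swap K = 1 := by
  ext ⟨i, k⟩ ⟨j, l⟩
  simp [swap, Matrix.mul_apply, Fintype.sum_prod_type, ite_and, Matrix.one_apply]

lemma isHermitian_swap : (swap K).IsHermitian := by
  ext ⟨i, k⟩ ⟨j, l⟩
  simp [swap, Matrix.conjTranspose_apply, apply_ite star]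
  grind

variable {K} in
lemma posSemidef_smul_one_sub_ent (hK : 1 ≤ K) : ((K : ℂ) • 1 - ent K).PosSemidef := by
  refine posSemidef_of_mul_self_eq_smul ?_ (c := K) (by exact_mod_cast hK) ?_
  · refine Matrix.IsHermitian.sub ?_ (posSemidef_ent K).1
    simp [Matrix.IsHermitian, Matrix.conjTranspose_smul]
  · simp only [Matrix.mul_sub, Matrix.sub_mul, ent_mul_ent, Matrix.smul_mul, Matrix.mul_smul,
      Matrix.one_mul, Matrix.mul_one, Complex.ofReal_natCast, smul_sub]
    abel

lemma posSemidef_one_add_swap : (1 + swap K).PosSemidef := by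
  refine posSemidef_of_mul_self_eq_smul (Matrix.isHermitian_one.add (isHermitian_swap K))
    (c := 2) (by norm_num) ?_
  simp only [Matrix.mul_add, Matrix.add_mul, swap_mul_swap, Matrix.one_mul, Matrix.mul_one,
    Complex.ofReal_ofNat, two_smul]
  abel

lemma posSemidef_one_sub_swap : (1 - swap K).PosSemidef := by
  refine posSemidef_of_mul_self_eq_smul (Matrix.isHermitian_one.sub (isHermitian_swap K))
    (c := 2) (by norm_num) ?_
  simp only [Matrix.mul_sub, Matrix.sub_mul, swap_mul_swap, Matrix.one_mul, Matrix.mul_one,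
    Complex.ofReal_ofNat, two_smul]
  abel

end Invariant

/-! ### From codes to operators -/

section Necessity

variable {K : ℕ} {A' B : Type*}

/-- The contraction of the systems `A` and `B'` of an operator on `ABA'B'` with an operator
on `AB'`. -/
def collapse (Z : Op ((Fin K × B) × (A' × Fin K))) : Op (Fin K × Fin K) →ₗ[ℂ] Op (A' × B) :=
  ofChoi (Z.submatrix (fun x => ((x.1.1, x.2.2), (x.2.1, x.1.2)))
    fun x => ((x.1.1, x.2.2), (x.2.1, x.1.2)))

lemma collapse_apply (Z : Op ((Fin K × B) × (A' × Fin K))) (W : Op (Fin K × Fin K))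
    (t t' : A' × B) : collapse Z W t t' =
      ∑ p, ∑ q, W p q * Z ((p.1, t.2), (t.1, p.2)) ((q.1, t'.2), (t'.1, q.2)) := rfl

lemma collapse_ent_apply (Z : Op ((Fin K × B) × (A' × Fin K))) (t t' : A' × B) :
    collapse Z (ent K) t t' = ∑ i, ∑ j, Z ((i, t.2), (t.1, i)) ((j, t'.2), (t'.1, j)) := by
  simp [collapse_apply, ent, Fintype.sum_prod_type, ite_and]

lemma collapse_one_apply (Z : Op ((Fin K × B) × (A' × Fin K))) (t t' : A' × B) :
    collapse Z 1 t t' = ∑ i, ∑ k, Z ((i, t.2), (t.1, k)) ((i, t'.2), (t'.1, k)) := by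
  simp only [collapse_apply, Matrix.one_apply, ite_mul, one_mul, zero_mul, Finset.sum_ite_eq,
    Finset.mem_univ, if_true]
  rw [Fintype.sum_prod_type]

lemma collapse_transposeBob_swap (Z : Op ((Fin K × B) × (A' × Fin K))) :
    collapse (transposeBob Z) (swap K) = transposeSnd (collapse Z (ent K)) := by
  ext t t'
  simp only [transposeSnd, Matrix.of_apply, collapse_ent_apply]
  simp [collapse_apply, swap, transposeBob, Fintype.sum_prod_type, ite_and]

lemma collapse_transposeBob_one (Z : Op ((Fin K × B) × (A' × Fin K))) :
    collapse (transposeBob Z) 1 = transposeSnd (collapse Z 1) := by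
  ext t t'
  simp only [transposeSnd, Matrix.of_apply, collapse_one_apply, transposeBob]

variable [Fintype A'] [Fintype B]

lemma posSemidef_collapse {Z : Op ((Fin K × B) × (A' × Fin K))} (hZ : Z.PosSemidef)
    {W : Op (Fin K × Fin K)} (hW : W.PosSemidef) : (collapse Z W).PosSemidef :=
  posSemidef_contract hW (hZ.submatrix _)

lemma channelFidelity_eq (M : Op (Fin K) →ₗ[ℂ] Op (Fin K)) :
    channelFidelity M = ((K : ℂ) ^ 2)⁻¹ * ∑ i, ∑ j, choi M (i, i) (j, j) := by
  simp only [channelFidelity, Matrix.trace, Matrix.diag_apply, Matrix.mul_apply, mapFst_apply,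
    maxEntangled, Matrix.of_apply, Fintype.sum_prod_type, ite_and, ite_mul, zero_mul,
    Finset.sum_ite_eq, Finset.sum_ite_eq', Finset.mem_univ, if_true, Finset.sum_const_zero,
    Finset.mul_sum, Finset.sum_ite_irrel]
  rw [Finset.sum_comm]
  refine Finset.sum_congr rfl fun i _ => Finset.sum_congr rfl fun j _ => ?_
  ring

variable (C : ForwardCode K A' B)

/-- The operator `K⁻² ⟨Φ|Z|Φ⟩` on `A'B`, for the Choi matrix `Z` of the code and
`|Φ⟩ = ∑ i, |i⟩|i⟩` on `AB'`. It determines the channel fidelity for every channel. -/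
def ForwardCode.fidelityOp [DecidableEq B] : Op (A' × B) :=
  ((K : ℂ) ^ 2)⁻¹ • collapse (choi C.bipartite) (ent K)

lemma ForwardCode.channelFidelity_overall [DecidableEq A'] [DecidableEq B] (N : Op A' →ₗ[ℂ] Op B) :
    channelFidelity (C.overall N) = ((choi N).transpose * C.fidelityOp).trace := by
  rw [channelFidelity_eq]
  simp only [C.choi_overall N, fidelityOp, Matrix.mul_smul, Matrix.trace_smul, smul_eq_mul]
  congr 1
  simp only [Matrix.trace, Matrix.diag_apply, Matrix.mul_apply, Matrix.transpose_apply,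
    collapse_ent_apply, Finset.mul_sum]
  simp only [← Fintype.sum_prod_type']
  exact Fintype.sum_equiv ⟨fun z : Fin K × Fin K × (A' × B) × (A' × B) =>
    (z.2.2.2, z.2.2.1, z.1, z.2.1), fun z => (z.2.2.1, z.2.2.2, z.2.1, z.1), fun _ => rfl,
    fun _ => rfl⟩ _ _ fun _ => rfl

lemma ForwardCode.averageInput_apply (a a' : A') :
    C.averageInput a a' = (K : ℂ)⁻¹ * ∑ i, ∑ q, choi C.E (i, (a, q)) (i, (a', q)) := by
  simp [averageInput, traceSnd, mapFst_apply, maxEntangled, ite_and, Finset.mul_sum]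
  exact Finset.sum_comm

/-- Bob cannot signal to Alice: her marginal output is the average channel input. -/
lemma ForwardCode.collapse_one [DecidableEq B] (hK : 1 ≤ K) :
    collapse (choi C.bipartite) 1 = (K : ℂ) • C.averageInput ⊗ₖ (1 : Op B) := by
  have hK0 : (K : ℂ) ≠ 0 := by exact_mod_cast (by omega : K ≠ 0)
  have h : ∀ p p', ∑ k, choi C.receiver (p, k) (p', k) = (1 : Op (Fin C.dimQ × B)) p p' :=
    fun p p' => congrFun (congrFun ((isOperation_iff_choi _).1 C.isOperation_receiver).2 p) p'
  ext ⟨a, b⟩ ⟨a', b'⟩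
  rw [collapse_one_apply, Matrix.smul_apply, Matrix.kroneckerMap_apply, C.averageInput_apply,
    smul_eq_mul, ← mul_assoc, ← mul_assoc, mul_inv_cancel₀ hK0, one_mul, Finset.sum_mul]
  refine Finset.sum_congr rfl fun i _ => ?_
  simp only [C.choi_bipartite]
  rw [Finset.sum_comm, Finset.sum_mul]
  refine Finset.sum_congr rfl fun q _ => ?_
  rw [Finset.sum_comm]
  simp only [← Finset.mul_sum, h, Matrix.one_apply, Prod.mk.injEq, ite_and, mul_ite, mul_one,
    mul_zero, Finset.sum_ite_eq, Finset.mem_univ, if_true]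

lemma ForwardCode.isFeasible_fidelityOp [DecidableEq A'] [DecidableEq B] (hK : 1 ≤ K)
    (N : Op A' →ₗ[ℂ] Op B) {f : ℝ} (hf : channelFidelity (C.overall N) = (f : ℂ)) :
    IsFeasible N C.averageInput f C.fidelityOp := by
  have hK0 : (K : ℂ) ≠ 0 := by exact_mod_cast (by omega : K ≠ 0)
  have hc : 0 ≤ ((K : ℂ) ^ 2)⁻¹ := by
    have h : 0 ≤ ((K : ℝ) ^ 2)⁻¹ := by positivity
    have h' := Complex.zero_le_real.2 h
    push_cast at h'
    exact h'
  refine ⟨hf.symm.trans (C.channelFidelity_overall N), ?_, ?_⟩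
  · have h := (posSemidef_collapse C.posSemidef_choi_bipartite
      (posSemidef_smul_one_sub_ent hK)).smul hc
    rw [map_sub, map_smul, C.collapse_one hK, smul_sub, smul_smul, smul_smul, pow_two,
      mul_assoc, inv_mul_cancel₀ (mul_ne_zero hK0 hK0), one_smul, ← pow_two] at h
    exact h
  · exact ((posSemidef_collapse C.posSemidef_choi_bipartite (posSemidef_ent K)).smul hc).nonneg

lemma ForwardCode.nsCondition_fidelityOp [DecidableEq B] (hC : IsNonSignallingAB C.bipartite) :
    NSCondition K C.fidelityOp := by
  obtain ⟨ZB, hZB, h⟩ := hC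
  ext b b'
  have h1 : ∀ i j, ∑ a, choi C.bipartite ((i, b), (a, i)) ((j, b'), (a, j)) =
      if i = j then choi ZB (b, i) (b', i) else 0 := by
    intro i j
    have h2 := congrFun (congrFun (h (Matrix.single (i, b) (j, b') 1)) i) j
    refine h2.trans ?_
    have h3 : traceFst (Matrix.single (i, b) (j, b') (1 : ℂ)) =
        if i = j then Matrix.single b b' 1 else 0 := by
      ext c c'
      by_cases hij : i = j
      · subst hij
        simp only [traceFst, Matrix.of_apply, Matrix.single_apply, Prod.mk.injEq, if_true]
        rw [Finset.sum_eq_single i] <;> grind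
      · simp [traceFst, Matrix.single_apply, hij]
        grind
    rw [h3]
    by_cases hij : i = j
    · subst hij
      simp [choi]
    · simp [hij]
  have h4 : ∑ k, choi ZB (b, k) (b', k) = (1 : Op B) b b' :=
    congrFun (congrFun ((isOperation_iff_choi _).1 hZB).2 b) b'
  simp only [traceFst, fidelityOp, Matrix.of_apply, Matrix.smul_apply, collapse_ent_apply,
    smul_eq_mul, ← Finset.mul_sum]
  rw [Finset.sum_comm, ← h4]
  congr 1
  refine Finset.sum_congr rfl fun i _ => ?_
  rw [Finset.sum_comm]
  simp [h1]

lemma ForwardCode.pptCondition_fidelityOp [DecidableEq B] [Nonempty B] (hK : 1 ≤ K)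
    (hC : IsPPTPreserving C.bipartite) : PPTCondition K C.averageInput C.fidelityOp := by
  have : Nonempty (Fin K) := ⟨⟨0, hK⟩⟩
  have hK0 : (K : ℂ) ≠ 0 := by exact_mod_cast (by omega : K ≠ 0)
  have hc : 0 ≤ ((K : ℂ) ^ 2)⁻¹ := by
    have h : 0 ≤ ((K : ℝ) ^ 2)⁻¹ := by positivity
    have h' := Complex.zero_le_real.2 h
    push_cast at h'
    exact h'
  have hZ := (isPPTPreserving_iff _).1 hC
  have h1 : collapse (transposeBob (choi C.bipartite)) 1 =
      (K : ℂ) • C.averageInput ⊗ₖ (1 : Op B) := by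
    rw [collapse_transposeBob_one, C.collapse_one hK]
    ext x y
    simp [transposeSnd, Matrix.one_apply, eq_comm]
  have h2 : transposeSnd C.fidelityOp =
      ((K : ℂ) ^ 2)⁻¹ • collapse (transposeBob (choi C.bipartite)) (swap K) := by
    rw [collapse_transposeBob_swap]
    rfl
  have h3 : (K : ℂ)⁻¹ • C.averageInput ⊗ₖ (1 : Op B) =
      ((K : ℂ) ^ 2)⁻¹ • collapse (transposeBob (choi C.bipartite)) 1 := by
    rw [h1, smul_smul]
    congr 1
    field_simp
  have hadd := (posSemidef_collapse hZ (posSemidef_one_add_swap K)).smul hc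
  have hsub := (posSemidef_collapse hZ (posSemidef_one_sub_swap K)).smul hc
  rw [map_add, smul_add] at hadd
  rw [map_sub, smul_sub] at hsub
  constructor
  · rw [Matrix.le_iff, h2, h3, sub_neg_eq_add, add_comm]
    exact hadd
  · rw [Matrix.le_iff, h2, h3]
    exact hsub

end Necessity

/-! ### From operators to codes -/

section Sufficiency

variable {K : ℕ} {A' B : Type*}

/-- The Choi matrix of the channel whose Choi state is the normalised projection onto the orthogonal
complement of the maximally entangled vector. For `K = 1` that projection vanishes, and the
identity channel is used. -/
def complEnt (K : ℕ) : Op (Fin K × Fin K) :=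
  if K = 1 then ent K else ((K : ℂ) ^ 2 - 1)⁻¹ • ((K : ℂ) • 1 - ent K)

lemma complEnt_of_two_le (hK : 2 ≤ K) :
    complEnt K = ((K : ℂ) ^ 2 - 1)⁻¹ • ((K : ℂ) • 1 - ent K) :=
  if_neg (by omega)

lemma sq_sub_one_ne_zero (hK : 2 ≤ K) : (K : ℂ) ^ 2 - 1 ≠ 0 := by
  have h : (1 : ℝ) < (K : ℝ) ^ 2 := by
    have : (2 : ℝ) ≤ K := by exact_mod_cast hK
    nlinarith
  have h' : ((K : ℝ) ^ 2 - 1) ≠ 0 := by linarith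
  exact_mod_cast h'

lemma posSemidef_complEnt (hK : 1 ≤ K) : (complEnt K).PosSemidef := by
  rcases hK.eq_or_lt with rfl | h
  · exact posSemidef_ent 1
  · rw [complEnt_of_two_le h]
    refine (posSemidef_smul_one_sub_ent hK).smul ?_
    have h1 : (2 : ℝ) ≤ K := by exact_mod_cast h
    have h2 : 0 ≤ ((K : ℝ) ^ 2 - 1)⁻¹ := inv_nonneg.2 (by nlinarith)
    have h3 := Complex.zero_le_real.2 h2
    push_cast at h3
    exact h3

lemma sum_ent (i j : Fin K) : ∑ k, ent K (i, k) (j, k) = if i = j then 1 else 0 := by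
  simp [ent, ite_and, eq_comm]

lemma sum_complEnt (hK : 1 ≤ K) (i j : Fin K) :
    ∑ k, complEnt K (i, k) (j, k) = if i = j then 1 else 0 := by
  rcases hK.eq_or_lt with rfl | h
  · exact sum_ent i j
  · have h1 := sq_sub_one_ne_zero h
    simp only [complEnt_of_two_le h, Matrix.smul_apply, Matrix.sub_apply, smul_eq_mul,
      ← Finset.mul_sum, Finset.sum_sub_distrib, sum_ent, Matrix.one_apply, Prod.mk.injEq, and_true]
    split_ifs
    · simp
      field_simp
    · simp

lemma ent_add_complEnt (hK : 1 ≤ K) (x y : Fin K × Fin K) :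
    ((K : ℂ) ^ 2)⁻¹ * ent K x y + (1 - ((K : ℂ) ^ 2)⁻¹) * complEnt K x y =
      (K : ℂ)⁻¹ * (1 : Op (Fin K × Fin K)) x y := by
  rcases hK.eq_or_lt with rfl | h
  · obtain rfl := Subsingleton.elim x y
    simp [ent, Subsingleton.elim x.1 x.2]
  · have h1 := sq_sub_one_ne_zero h
    have h2 : (K : ℂ) ≠ 0 := by exact_mod_cast (by omega : K ≠ 0)
    rw [complEnt_of_two_le h, Matrix.smul_apply, Matrix.sub_apply, Matrix.smul_apply]
    simp only [smul_eq_mul]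
    field_simp
    ring

lemma sum_ent_diag : ∑ i, ∑ j, ent K (i, i) (j, j) = (K : ℂ) ^ 2 := by
  simp [ent, pow_two]

lemma sum_complEnt_diag (hK : 2 ≤ K) : ∑ i, ∑ j, complEnt K (i, i) (j, j) = 0 := by
  simp only [complEnt_of_two_le hK, Matrix.smul_apply, Matrix.sub_apply, smul_eq_mul,
    ← Finset.mul_sum, Finset.sum_sub_distrib, sum_ent_diag, Matrix.one_apply, Prod.mk.injEq,
    and_self]
  simp [pow_two]

/-- The partial transpose of `complEnt`, in terms of the projections onto the symmetric and
antisymmetric subspaces, together with that of `ent`. -/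
lemma swap_combination (hK : 2 ≤ K) (w r s o : ℂ) :
    w * s + (r - w) * (((K : ℂ) ^ 2 - 1)⁻¹ * (K * o - s)) =
      (2 * ((K : ℂ) + 1))⁻¹ * ((r + K * w) * (o + s)) +
        (2 * ((K : ℂ) - 1))⁻¹ * ((r - K * w) * (o - s)) := by
  have h := sq_sub_one_ne_zero hK
  have h1 : (K : ℂ) ^ 2 - 1 = (K - 1) * (K + 1) := by ring
  rw [h1] at h
  have h2 := left_ne_zero_of_mul h
  have h3 := right_ne_zero_of_mul h
  rw [h1]
  field_simp
  ring

variable [Fintype A'] [Fintype B] [DecidableEq B]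

lemma sandwich_apply {S : Op A'} (hS : S.IsHermitian) (M : Op (A' × B)) (x y : A' × B) :
    ((S ⊗ₖ (1 : Op B)) * M * (S ⊗ₖ (1 : Op B))) x y =
      ∑ c, ∑ c', S x.1 c * star (S y.1 c') * M (c, x.2) (c', y.2) := by
  have h : ∀ c, star (S y.1 c) = S c y.1 := fun c => hS.apply c y.1
  simp only [Matrix.mul_apply, Matrix.kroneckerMap_apply, Matrix.one_apply, mul_ite, mul_one,
    mul_zero, ite_mul, zero_mul, Fintype.sum_prod_type, Finset.sum_ite_eq, Finset.sum_ite_eq',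
    Finset.mem_univ, if_true, Finset.sum_mul, h]
  rw [Finset.sum_comm]
  refine Finset.sum_congr rfl fun c _ => Finset.sum_congr rfl fun c' _ => ?_
  ring

/-- The Choi matrix of the bipartite map of the code is `Λ ⊗ K φ + (ρ ⊗ 1 - Λ) ⊗ complEnt K`, with
`Λ` and `ρ ⊗ 1` on `A'B` and the other factors on `AB'`. -/
def HasInvariantChoi (C : ForwardCode K A' B) (ρ : Op A') (L : Op (A' × B)) : Prop :=
  ∀ x y, choi C.bipartite x y =
    L (x.2.1, x.1.2) (y.2.1, y.1.2) * ent K (x.1.1, x.2.2) (y.1.1, y.2.2) +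
    (ρ ⊗ₖ (1 : Op B) - L) (x.2.1, x.1.2) (y.2.1, y.1.2) *
      complEnt K (x.1.1, x.2.2) (y.1.1, y.2.2)

/-- The code attached to `0 ≤ Λ ≤ ρ ⊗ 1`. Alice sends her input to Bob, together with the purifying
system `A'` of the channel input state `ρ`. With `Λ = (√ρ ⊗ 1) M (√ρ ⊗ 1)`, Bob performs the
measurement with effects `Mᵀ` and `1 - Mᵀ` on the purifying system and the channel output; after
the first outcome he returns Alice's input, and after the second he first applies the channel with
Choi matrix `complEnt K`. -/
lemma exists_code [DecidableEq A'] (hK : 1 ≤ K) {ρ : Op A'} (hρ : IsState ρ) {L : Op (A' × B)}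
    (h0 : 0 ≤ L) (h1 : L ≤ ρ ⊗ₖ (1 : Op B)) :
    ∃ C : ForwardCode K A' B, C.averageInput = ρ ∧ HasInvariantChoi C ρ L := by
  have hK0 : (K : ℂ) ≠ 0 := by exact_mod_cast (by omega : K ≠ 0)
  let S : Op A' := CFC.sqrt ρ
  have hSp : S.PosSemidef := Matrix.nonneg_iff_posSemidef.1 (CFC.sqrt_nonneg ρ)
  have hSS : S * S = ρ := CFC.sqrt_mul_sqrt_self ρ hρ.1
  have hT : (S ⊗ₖ (1 : Op B)) * (S ⊗ₖ (1 : Op B)) = ρ ⊗ₖ (1 : Op B) := by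
    rw [← Matrix.mul_kronecker_mul, hSS, Matrix.one_mul]
  obtain ⟨M, hM0, hM1, hM⟩ := exists_sandwich (hSp.kronecker Matrix.PosSemidef.one).1
    (Matrix.nonneg_iff_posSemidef.1 h0) (by rw [hT]; exact h1)
  have hM' : ρ ⊗ₖ (1 : Op B) - L = (S ⊗ₖ (1 : Op B)) * (1 - M) * (S ⊗ₖ (1 : Op B)) := by
    rw [Matrix.mul_sub, Matrix.sub_mul, Matrix.mul_one, hT, ← hM]
  have hSdiag : ∀ a a', ∑ c, S a c * star (S a' c) = ρ a a' := by
    intro a a'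
    rw [← hSS, Matrix.mul_apply]
    exact Finset.sum_congr rfl fun c _ => by rw [hSp.1.apply]
  let e := Fintype.equivFin (Fin K × A')
  let n := Fintype.card (Fin K × A')
  let v : Fin K × (A' × Fin n) → ℂ := fun x =>
    if x.1 = (e.symm x.2.2).1 then S x.2.1 (e.symm x.2.2).2 else 0
  let cE : Op (Fin K × (A' × Fin n)) := Matrix.of fun x y => v x * star (v y)
  let g : (Fin n × B) × Fin K → (A' × B) × (Fin K × Fin K) := fun x =>
    (((e.symm x.1.1).2, x.1.2), ((e.symm x.1.1).1, x.2))
  let cD : Op ((Fin n × B) × Fin K) :=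
    (M ⊗ₖ ent K + (1 - M) ⊗ₖ complEnt K).submatrix g g
  have hE : IsOperation (ofChoi cE) := by
    rw [isOperation_iff_choi, choi_ofChoi]
    refine ⟨posSemidef_of_entries (Matrix.posSemidef_vecMulVec_self_star v) fun x y => rfl, ?_⟩
    ext i j
    simp only [traceSnd, Matrix.of_apply, cE, v, Fintype.sum_prod_type]
    have h2 : ∀ a, ∑ q, (if i = (e.symm q).1 then S a (e.symm q).2 else 0) *
        star (if j = (e.symm q).1 then S a (e.symm q).2 else 0) = if i = j then ρ a a else 0 := by
      intro a
      rw [e.symm.sum_comp (fun p : Fin K × A' => (if i = p.1 then S a p.2 else 0) *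
        star (if j = p.1 then S a p.2 else 0)), Fintype.sum_prod_type]
      simp only [ite_mul, zero_mul, Finset.sum_ite_irrel, Finset.sum_const_zero, Finset.sum_ite_eq,
        Finset.mem_univ, if_true, apply_ite star, star_zero, mul_ite, mul_zero, hSdiag]
    refine (Finset.sum_congr rfl fun a _ => h2 a).trans ?_
    have h3 : ∑ a, ρ a a = 1 := hρ.2
    rw [Matrix.one_apply]
    split_ifs
    · exact h3
    · exact Finset.sum_const_zero
  have hD : IsOperation (ofChoi cD) := by
    rw [isOperation_iff_choi, choi_ofChoi]
    refine ⟨((hM0.kronecker (posSemidef_ent K)).add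
      (hM1.kronecker (posSemidef_complEnt hK))).submatrix g, ?_⟩
    ext ⟨q, b⟩ ⟨q', b'⟩
    simp only [traceSnd, Matrix.of_apply, cD, Matrix.submatrix_apply, Matrix.add_apply,
      Matrix.kroneckerMap_apply, g, Finset.sum_add_distrib, ← Finset.mul_sum, sum_ent,
      sum_complEnt hK, ← add_mul, Matrix.sub_apply, add_sub_cancel]
    obtain ⟨q, rfl⟩ := e.surjective q
    obtain ⟨q', rfl⟩ := e.surjective q'
    simp only [Matrix.one_apply, Prod.ext_iff, Equiv.symm_apply_apply, e.apply_eq_iff_eq]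
    grind
  let C : ForwardCode K A' B := ⟨n, n, ofChoi cE, LinearMap.id, ofChoi cD, hE, .id, hD⟩
  have hCE : choi C.E = cE := choi_ofChoi cE
  have hCR : choi C.receiver = cD := choi_ofChoi cD
  refine ⟨C, ?_, ?_⟩
  · ext a a'
    rw [C.averageInput_apply, hCE]
    have h2 : ∀ i, ∑ q, cE (i, (a, q)) (i, (a', q)) = ρ a a' := by
      intro i
      refine (e.symm.sum_comp (fun p : Fin K × A' => (if i = p.1 then S a p.2 else 0) *
        star (if i = p.1 then S a' p.2 else 0))).trans ?_
      rw [Fintype.sum_prod_type]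
      simp only [ite_mul, zero_mul, Finset.sum_ite_irrel, Finset.sum_const_zero, Finset.sum_ite_eq,
        Finset.mem_univ, if_true, hSdiag]
    refine (congrArg _ (Finset.sum_congr rfl fun i _ => h2 i)).trans ?_
    rw [Finset.sum_const, Finset.card_univ, Fintype.card_fin, nsmul_eq_mul, ← mul_assoc,
      inv_mul_cancel₀ hK0, one_mul]
  · rintro ⟨⟨i, b⟩, a, k⟩ ⟨⟨j, b'⟩, a', l⟩
    rw [C.choi_bipartite, hCE, hCR, hM']
    nth_rw 1 [hM]
    rw [sandwich_apply hSp.1, sandwich_apply hSp.1]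
    let F : Fin K × A' → Fin K × A' → ℂ := fun p p' =>
      (if i = p.1 then S a p.2 else 0) * star (if j = p'.1 then S a' p'.2 else 0) *
        (M (p.2, b) (p'.2, b') * ent K (p.1, k) (p'.1, l) +
          (1 - M) (p.2, b) (p'.2, b') * complEnt K (p.1, k) (p'.1, l))
    have h2 : ∀ q, ∑ q', cE (i, (a, q)) (j, (a', q')) * cD ((q, b), k) ((q', b'), l) =
        ∑ p', F (e.symm q) p' := fun q => e.symm.sum_comp (F (e.symm q))
    refine (Finset.sum_congr rfl fun q _ => h2 q).trans ?_
    refine (e.symm.sum_comp (fun p => ∑ p', F p p')).trans ?_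
    simp only [F, Fintype.sum_prod_type, ite_mul, zero_mul, Finset.sum_ite_irrel,
      Finset.sum_const_zero, Finset.sum_ite_eq, Finset.mem_univ, if_true, apply_ite star,
      star_zero, mul_ite, mul_zero, mul_add, Finset.sum_add_distrib, Finset.sum_mul]
    simp only [mul_assoc]

end Sufficiency

section Properties

variable {K : ℕ} {A' B : Type*} [Fintype A'] [Fintype B] [DecidableEq B]
  {C : ForwardCode K A' B} {ρ : Op A'} {L : Op (A' × B)}

/-- For `K = 1` the code only sees `ρ ⊗ 1`, hence the extra hypothesis. -/
lemma HasInvariantChoi.fidelityOp_eq (h : HasInvariantChoi C ρ L) (hK : 1 ≤ K)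
    (hL : K = 1 → L = ρ ⊗ₖ (1 : Op B)) : C.fidelityOp = L := by
  ext t t'
  have hK0 : (K : ℂ) ≠ 0 := by exact_mod_cast (by omega : K ≠ 0)
  simp only [ForwardCode.fidelityOp, Matrix.smul_apply, collapse_ent_apply, h _ _,
    Finset.sum_add_distrib, ← Finset.mul_sum, sum_ent_diag, smul_eq_mul]
  rcases hK.eq_or_lt with rfl | h2
  · simp [hL rfl]
  · rw [sum_complEnt_diag h2]
    field_simp
    ring

/-- Bob's marginal output is maximally mixed whatever the inputs: the reduced operators of `Λ` and
`ρ ⊗ 1 - Λ` are `K⁻² 1` and `(1 - K⁻²) 1`, the weights of the maximally entangled state and of its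
complement in the maximally mixed state. -/
lemma HasInvariantChoi.isNonSignallingAB (h : HasInvariantChoi C ρ L) (hK : 1 ≤ K)
    (hρ : ρ.trace = 1) (hL : NSCondition K L) : IsNonSignallingAB C.bipartite := by
  have hK0 : (K : ℂ) ≠ 0 := by exact_mod_cast (by omega : K ≠ 0)
  refine ⟨ofChoi ((K : ℂ)⁻¹ • 1), ?_, fun X => ?_⟩
  · rw [isOperation_iff_choi, choi_ofChoi]
    constructor
    · refine Matrix.PosSemidef.one.smul ?_
      have h1 : 0 ≤ (K : ℝ)⁻¹ := by positivity
      have h2 := Complex.zero_le_real.2 h1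
      push_cast at h2
      exact h2
    · ext b b'
      simp [traceSnd, Matrix.one_apply, hK0]
  · have hL' : ∀ b b', ∑ a, L (a, b) (a, b') = ((K : ℂ) ^ 2)⁻¹ * (1 : Op B) b b' :=
      fun b b' => congrFun (congrFun hL b) b'
    have hR : ∀ b b', ∑ a, (ρ ⊗ₖ (1 : Op B)) (a, b) (a, b') = (1 : Op B) b b' := by
      intro b b'
      simp only [Matrix.kroneckerMap_apply]
      have h1 : ∑ a, ρ a a * (1 : Op B) b b' = (∑ a, ρ a a) * (1 : Op B) b b' :=
        (Finset.sum_mul _ _ _).symm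
      exact h1.trans (by rw [show ∑ a, ρ a a = 1 from hρ, one_mul])
    have hsum : ∀ (p q : Fin K × B) (k l : Fin K),
        ∑ a, choi C.bipartite (p, (a, k)) (q, (a, l)) =
          (K : ℂ)⁻¹ * ((1 : Op B) p.2 q.2 * (1 : Op (Fin K × Fin K)) (p.1, k) (q.1, l)) := by
      intro p q k l
      simp only [h _ _, Finset.sum_add_distrib, ← Finset.sum_mul, Matrix.sub_apply,
        Finset.sum_sub_distrib, hL', hR]
      linear_combination (1 : Op B) p.2 q.2 * ent_add_complEnt hK (p.1, k) (q.1, l)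
    ext k l
    have h1 : traceFst (C.bipartite X) k l = ∑ p, ∑ q, X p q *
        ((K : ℂ)⁻¹ * ((1 : Op B) p.2 q.2 * (1 : Op (Fin K × Fin K)) (p.1, k) (q.1, l))) := by
      simp only [traceFst, Matrix.of_apply, apply_eq_sum_choi C.bipartite X, ← hsum,
        Finset.mul_sum]
      rw [Finset.sum_comm]
      exact Finset.sum_congr rfl fun p _ => Finset.sum_comm
    rw [h1, ofChoi_apply]
    simp only [traceFst, Matrix.of_apply, Matrix.smul_apply, smul_eq_mul, Matrix.one_apply,
      Prod.mk.injEq, ite_and, Fintype.sum_prod_type, Finset.sum_mul, mul_ite, mul_one,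
      mul_zero, Finset.sum_ite_irrel, Finset.sum_const_zero, Finset.sum_ite_eq,
      Finset.mem_univ, if_true]
    rw [Finset.sum_comm]

/-- Partial transposition turns `K φ` into the swap operator, and the Choi matrix of the code into a
combination, with positive coefficients, of `ρ ⊗ 1 + K t_B(Λ)` on the symmetric subspace and
`ρ ⊗ 1 - K t_B(Λ)` on the antisymmetric subspace. -/
lemma HasInvariantChoi.isPPTPreserving [Nonempty B] (h : HasInvariantChoi C ρ L) (hK : 1 ≤ K)
    (hρ : 0 ≤ ρ) (hK1 : K = 1 → L = ρ ⊗ₖ (1 : Op B)) (hL : PPTCondition K ρ L) :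
    IsPPTPreserving C.bipartite := by
  have hne : Nonempty (Fin K) := ⟨⟨0, hK⟩⟩
  rw [isPPTPreserving_iff]
  have hR : ∀ t t' : A' × B,
      (ρ ⊗ₖ (1 : Op B)) (t.1, t'.2) (t'.1, t.2) = (ρ ⊗ₖ (1 : Op B)) t t' := by
    intro t t'
    simp [Matrix.one_apply, eq_comm]
  let g : (Fin K × B) × (A' × Fin K) → (A' × B) × (Fin K × Fin K) :=
    fun x => ((x.2.1, x.1.2), (x.1.1, x.2.2))
  rcases hK.eq_or_lt with rfl | h2
  · refine posSemidef_of_entries ((((Matrix.nonneg_iff_posSemidef.1 hρ).kronecker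
      Matrix.PosSemidef.one).kronecker (posSemidef_ent 1)).submatrix g) fun x y => ?_
    simp only [transposeBob, Matrix.of_apply, h _ _, hK1 rfl, sub_self, Matrix.zero_apply, zero_mul,
      add_zero, Matrix.submatrix_apply, g]
    rw [Matrix.kroneckerMap_apply (fun a b => a * b) (ρ ⊗ₖ (1 : Op B)),
      ← hR (x.2.1, x.1.2) (y.2.1, y.1.2)]
    congr 2 <;> exact Subsingleton.elim _ _
  · have hK0 : (K : ℂ) ≠ 0 := by exact_mod_cast (by omega : K ≠ 0)
    have hKn : (0 : ℂ) ≤ K := by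
      have := Complex.zero_le_real.2 (Nat.cast_nonneg (α := ℝ) K)
      rwa [Complex.ofReal_natCast] at this
    have hp : (ρ ⊗ₖ (1 : Op B) + (K : ℂ) • transposeSnd L).PosSemidef := by
      have := (Matrix.le_iff.1 hL.1).smul hKn
      rwa [sub_neg_eq_add, smul_add, smul_smul, mul_inv_cancel₀ hK0, one_smul, add_comm] at this
    have hm : (ρ ⊗ₖ (1 : Op B) - (K : ℂ) • transposeSnd L).PosSemidef := by
      have := (Matrix.le_iff.1 hL.2).smul hKn
      rwa [smul_sub, smul_smul, mul_inv_cancel₀ hK0, one_smul] at this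
    have hK2 : (2 : ℝ) ≤ K := by exact_mod_cast h2
    have hc1 : 0 ≤ (2 * ((K : ℂ) + 1))⁻¹ := by
      have h3 : 0 ≤ (2 * ((K : ℝ) + 1))⁻¹ := by positivity
      have h4 := Complex.zero_le_real.2 h3
      push_cast at h4
      exact h4
    have hc2 : 0 ≤ (2 * ((K : ℂ) - 1))⁻¹ := by
      have h3 : 0 ≤ (2 * ((K : ℝ) - 1))⁻¹ := inv_nonneg.2 (by linarith)
      have h4 := Complex.zero_le_real.2 h3
      push_cast at h4
      exact h4
    refine posSemidef_of_entries ((((hp.kronecker (posSemidef_one_add_swap K)).smul hc1).add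
      ((hm.kronecker (posSemidef_one_sub_swap K)).smul hc2)).submatrix g) fun x y => ?_
    obtain ⟨⟨i, b⟩, a, k⟩ := x
    obtain ⟨⟨j, b'⟩, a', l⟩ := y
    have hswap : ent K (i, l) (j, k) = swap K (i, k) (j, l) := by
      simp only [ent, swap, Matrix.of_apply, eq_comm]
    have hone : (1 : Op (Fin K × Fin K)) (i, l) (j, k) =
        (1 : Op (Fin K × Fin K)) (i, k) (j, l) := by
      simp only [Matrix.one_apply, Prod.mk.injEq, eq_comm]
    have hcomb := swap_combination h2 (L (a, b') (a', b)) ((ρ ⊗ₖ (1 : Op B)) (a, b) (a', b'))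
      (swap K (i, k) (j, l)) ((1 : Op (Fin K × Fin K)) (i, k) (j, l))
    simp only [transposeBob, Matrix.of_apply, h _ _, complEnt_of_two_le h2, Matrix.smul_apply,
      Matrix.sub_apply, smul_eq_mul, hswap, hone]
    rw [hR (a, b) (a', b'), hcomb]
    rfl

end Properties

end QCode

end

theorem theorem1 {A' B : Type*} [Fintype A'] [Fintype B] [DecidableEq A'] [DecidableEq B]
    (K : ℕ) (hK : 1 ≤ K)
    (N : QCode.Op A' →ₗ[ℂ] QCode.Op B) (hN : QCode.IsOperation N)
    (ρ : QCode.Op A') (hρ : QCode.IsState ρ) (f : ℝ) :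
    -- non-signalling codes
    ((∃ C : QCode.ForwardCode K A' B, QCode.IsNonSignallingAB C.bipartite ∧
        C.averageInput = ρ ∧ QCode.channelFidelity (C.overall N) = (f : ℂ)) ↔
      ∃ Λ : QCode.Op (A' × B), QCode.IsFeasible N ρ f Λ ∧ QCode.NSCondition K Λ) ∧
    -- PPT-preserving codes
    (2 ≤ K →
      ((∃ C : QCode.ForwardCode K A' B, QCode.IsPPTPreserving C.bipartite ∧
          C.averageInput = ρ ∧ QCode.channelFidelity (C.overall N) = (f : ℂ)) ↔
        ∃ Λ : QCode.Op (A' × B), QCode.IsFeasible N ρ f Λ ∧ QCode.PPTCondition K ρ Λ)) ∧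
    -- codes that are both non-signalling and PPT-preserving
    ((∃ C : QCode.ForwardCode K A' B, QCode.IsNonSignallingAB C.bipartite ∧
        QCode.IsPPTPreserving C.bipartite ∧
        C.averageInput = ρ ∧ QCode.channelFidelity (C.overall N) = (f : ℂ)) ↔
      ∃ Λ : QCode.Op (A' × B), QCode.IsFeasible N ρ f Λ ∧ QCode.NSCondition K Λ ∧
        QCode.PPTCondition K ρ Λ) := by
  have hne : Nonempty B := by
    by_contra hB
    rw [not_nonempty_iff] at hB
    have h1 := hN.tracePreserving ρ
    rw [hρ.2] at h1
    simp [Matrix.trace] at h1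
  -- for a code of size one, the non-signalling condition forces `Λ = ρ ⊗ 1`
  have hone : ∀ {L : QCode.Op (A' × B)}, QCode.IsFeasible N ρ f L → QCode.NSCondition K L →
      K = 1 → L = ρ ⊗ₖ (1 : QCode.Op B) := by
    rintro L hL hns rfl
    have h1 : (ρ ⊗ₖ (1 : QCode.Op B) - L).PosSemidef := hL.2.1
    have h2 : L.trace = ∑ b, QCode.traceFst L b b := by
      simp only [Matrix.trace, Matrix.diag_apply, Fintype.sum_prod_type, QCode.traceFst,
        Matrix.of_apply]
      exact Finset.sum_comm
    have h3 : (ρ ⊗ₖ (1 : QCode.Op B) - L).trace = 0 := by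
      rw [Matrix.trace_sub, Matrix.trace_kronecker, hρ.2, h2, hns]
      simp
    exact (sub_eq_zero.1 (h1.trace_eq_zero_iff.1 h3)).symm
  have hsuff : ∀ {L : QCode.Op (A' × B)}, QCode.IsFeasible N ρ f L →
      (K = 1 → L = ρ ⊗ₖ (1 : QCode.Op B)) → ∃ C : QCode.ForwardCode K A' B,
        QCode.HasInvariantChoi C ρ L ∧ C.averageInput = ρ ∧
          QCode.channelFidelity (C.overall N) = (f : ℂ) := by
    intro L hL hK1
    obtain ⟨C, hCρ, hC⟩ := QCode.exists_code hK hρ hL.2.2 hL.2.1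
    refine ⟨C, hC, hCρ, ?_⟩
    rw [C.channelFidelity_overall, QCode.HasInvariantChoi.fidelityOp_eq hC hK hK1, hL.1]
  refine ⟨⟨?_, ?_⟩, fun hK2 => ⟨?_, ?_⟩, ?_, ?_⟩
  · rintro ⟨C, hns, rfl, hf⟩
    exact ⟨_, C.isFeasible_fidelityOp hK N hf, C.nsCondition_fidelityOp hns⟩
  · rintro ⟨L, hL, hns⟩
    obtain ⟨C, hC, hCρ, hf⟩ := hsuff hL (hone hL hns)
    exact ⟨C, hC.isNonSignallingAB hK hρ.2 hns, hCρ, hf⟩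
  · rintro ⟨C, hppt, rfl, hf⟩
    exact ⟨_, C.isFeasible_fidelityOp hK N hf, C.pptCondition_fidelityOp hK hppt⟩
  · rintro ⟨L, hL, hppt⟩
    have hK1 : K = 1 → L = ρ ⊗ₖ (1 : QCode.Op B) := fun h => by omega
    obtain ⟨C, hC, hCρ, hf⟩ := hsuff hL hK1
    exact ⟨C, hC.isPPTPreserving hK hρ.1 hK1 hppt, hCρ, hf⟩
  · rintro ⟨C, hns, hppt, rfl, hf⟩
    exact ⟨_, C.isFeasible_fidelityOp hK N hf, C.nsCondition_fidelityOp hns,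
      C.pptCondition_fidelityOp hK hppt⟩
  · rintro ⟨L, hL, hns, hppt⟩
    obtain ⟨C, hC, hCρ, hf⟩ := hsuff hL (hone hL hns)
    exact ⟨C, hC.isNonSignallingAB hK hρ.2 hns,
      hC.isPPTPreserving hK hρ.1 (hone hL hns) hppt, hCρ, hf⟩
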